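/- **Setting.** There are $n$ jobs with unknown processing times $p_1,\dots,p_n\ge 0$ on a single unit-speed machine that may be shared between jobs (arbitrary preemption). Let $e_j(t)$ be the processing that job $j$ has received until time $t$ and let $C_j$ be its completion time, the earliest $t\ge 0$ with $e_j(t)\ge p_j$. The cost of a schedule is $\sum_j C_j$; $\mathrm{OPT}$ is the least cost of any schedule of the jobs. A number $\alpha\in(0,1]$ is known; job $j$ emits a signal when its elapsed time reaches $\beta_j p_j$, where $\beta_j\in[0,1]$ is unknown. **Algorithm.** Let $\rho\in(0,1]$. Run Shortest Elapsed Time First (SETF) on the uncompleted jobs, i.e. at each moment process at equal rates (of sum $1$) all uncompleted jobs of least elapsed time. Whenever a job $j$ emits its signal, at a time $t$, interrupt SETF and run $j$ alone for $\left(\frac{1}{\alpha\rho}-1\right)e_j(t)$ units of time, or until it completes if this happens earlier; then resume. Jobs that emit their signals at the same time get this preferential execution one after the other, in an arbitrary order. $\mathrm{ALG}$ denotes the cost of the resulting schedule. **Theorem.** For all $\alpha,\rho\in(0,1]$, the algorithm has an execution on every instance, each of its executions is a schedule that completes all jobs, and for all $n$, all $p_1,\dots,p_n\ge 0$ and all ways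 of ordering simultaneous signals: 1. ($(1+\alpha)$-consistency) if $\beta_j=\alpha$ for all $j$, then $\mathrm{ALG}\le(1+\alpha)\,\mathrm{OPT}$; 2. ($(1+\frac1{\rho\alpha})$-robustness) for all $\beta_1,\dots,\beta_n\in[0,1]$, $\mathrm{ALG}\le\left(1+\frac{1}{\rho\alpha}\right)\mathrm{OPT}$; 3. if $\rho\in(0,1)$, then for all $\beta_1,\dots,\beta_n\in[0,1]$, $$\mathrm{ALG}\le(1+\alpha)\,\mathrm{OPT}+\frac{2n}{\rho(1-\rho)\alpha^2}\sum_{i=1}^n|\beta_i-\alpha|\,p_i .$$ -/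

import Mathlib

noncomputable section

namespace SignalScheduling

/-! ### Preemptive schedules on a single machine -/

/-- `e j t` is the processing that job `j` has received until time `t`. The machine has unit
speed and may be shared between jobs (arbitrary, infinitesimal preemption); every job is
eventually completed. Only times `t ≥ 0` matter. -/
structure IsSchedule {n : ℕ} (p : Fin n → ℝ) (e : Fin n → ℝ → ℝ) : Prop where
  start : ∀ j, e j 0 = 0
  mono : ∀ j, ∀ s t : ℝ, 0 ≤ s → s ≤ t → e j s ≤ e j t
  speed : ∀ s t : ℝ, 0 ≤ s → s ≤ t → ∑ j, (e j t - e j s) ≤ t - s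
  completes : ∀ j, ∃ t : ℝ, 0 ≤ t ∧ p j ≤ e j t

/-- Completion time: the earliest `t ≥ 0` with `e j t ≥ p j`. -/
def completionTime {n : ℕ} (p : Fin n → ℝ) (e : Fin n → ℝ → ℝ) (j : Fin n) : ℝ :=
  sInf {t : ℝ | 0 ≤ t ∧ p j ≤ e j t}

/-- The objective: the total completion time. -/
def totalCompletionTime {n : ℕ} (p : Fin n → ℝ) (e : Fin n → ℝ → ℝ) : ℝ :=
  ∑ j, completionTime p e j

/-- The optimal total completion time over all preemptive schedules. -/
def OPT {n : ℕ} (p : Fin n → ℝ) : ℝ :=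
  sInf {c : ℝ | ∃ e : Fin n → ℝ → ℝ, IsSchedule p e ∧ c = totalCompletionTime p e}

/-! ### The algorithm

Shortest Elapsed Time First, interrupted by preferential executions: when job `j` emits its
signal, i.e. when its elapsed time reaches `β j * p j`, it is run alone for
`(1 / (α * ρ) - 1) * e_j` time units, or until it completes if this happens earlier. -/

/-- State of the algorithm between two phases. -/
structure State (n : ℕ) where
  /-- the current time -/
  time : ℝ
  /-- the elapsed time of each job -/
  elapsed : Fin n → ℝ
  /-- the jobs that have already received their preferential execution -/
  served : Finset (Fin n)

/-- The initial state. -/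
def State.init (n : ℕ) : State n := ⟨0, fun _ => 0, ∅⟩

/-- Job `j` is not completed. -/
def Unfinished {n : ℕ} (p : Fin n → ℝ) (s : State n) (j : Fin n) : Prop :=
  s.elapsed j < p j

/-- Job `j` is not completed, has emitted its signal, and still waits for its preferential
execution. -/
def Pending {n : ℕ} (p β : Fin n → ℝ) (s : State n) (j : Fin n) : Prop :=
  Unfinished p s j ∧ β j * p j ≤ s.elapsed j ∧ j ∉ s.served

open Classical in
/-- The uncompleted jobs of least elapsed time: the jobs that SETF processes. -/
def lowest {n : ℕ} (p : Fin n → ℝ) (s : State n) : Finset (Fin n) :=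
  Finset.univ.filter fun j =>
    Unfinished p s j ∧ ∀ i, Unfinished p s i → s.elapsed j ≤ s.elapsed i

/-- All jobs that SETF currently processes can receive a further amount `x` each without passing
an event: the completion or the signal of one of them, or the moment at which they catch up
with another uncompleted job. -/
def NoEventBefore {n : ℕ} (p β : Fin n → ℝ) (s : State n) (x : ℝ) : Prop :=
  0 ≤ x ∧ ∀ j ∈ lowest p s,
    s.elapsed j + x ≤ p j ∧
    (j ∉ s.served → s.elapsed j + x ≤ β j * p j) ∧
    ∀ i, Unfinished p s i → i ∉ lowest p s → s.elapsed j + x ≤ s.elapsed i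

open Classical in
/-- `Phase α ρ p β s d r S`: from state `s` the algorithm may run, for `d` time units, every job
`j` at the constant rate `r j`, after which `S` is the set of jobs that have received their
preferential execution. Signals emitted simultaneously are served one after the other, in an
arbitrary order. -/
inductive Phase {n : ℕ} (α ρ : ℝ) (p β : Fin n → ℝ) (s : State n) :
    ℝ → (Fin n → ℝ) → Finset (Fin n) → Prop
  /-- preferential execution of `j`, stopped early if `j` completes -/
  | prefer (j : Fin n) (hj : Pending p β s j) :
      Phase α ρ p β s (min ((1 / (α * ρ) - 1) * s.elapsed j) (p j - s.elapsed j))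
        (fun i => if i = j then 1 else 0) (insert j s.served)
  /-- SETF up to the next event -/
  | setf (x : ℝ) (hp : ∀ j, ¬ Pending p β s j) (hu : ∃ j, Unfinished p s j)
      (hx : IsGreatest {y : ℝ | NoEventBefore p β s y} x) :
      Phase α ρ p β s ((lowest p s).card * x)
        (fun i => if i ∈ lowest p s then 1 / ((lowest p s).card : ℝ) else 0) s.served
  /-- all jobs are completed: the machine idles (one unit of time after the other) -/
  | idle (hu : ∀ j, ¬ Unfinished p s j) :
      Phase α ρ p β s 1 (fun _ => 0) s.served

/-- `e` is the evolution of the elapsed times in an execution of the algorithm with parameters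
`α`, `ρ` on jobs with processing times `p` that emit their signals after the fractions `β`. -/
def IsExecution (α ρ : ℝ) {n : ℕ} (p β : Fin n → ℝ) (e : Fin n → ℝ → ℝ) : Prop :=
  ∃ (s : ℕ → State n) (d : ℕ → ℝ) (r : ℕ → Fin n → ℝ),
    s 0 = State.init n ∧
    ∀ m,
      Phase α ρ p β (s m) (d m) (r m) (s (m + 1)).served ∧
      (s (m + 1)).time = (s m).time + d m ∧
      (∀ j, (s (m + 1)).elapsed j = (s m).elapsed j + d m * r m j) ∧
      ∀ j, ∀ t ∈ Set.Icc (s m).time (s (m + 1)).time,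
        e j t = (s m).elapsed j + (t - (s m).time) * r m j

/-! ### Performance guarantees -/

/-- A scheduling algorithm with signals, given by its possible executions on each instance
`(n, p, β)`. -/
abbrev Algorithm : Type := ∀ {n : ℕ}, (Fin n → ℝ) → (Fin n → ℝ) → (Fin n → ℝ → ℝ) → Prop

/-- An instance: processing times and signal fractions in `[0, 1]`. -/
structure IsInstance {n : ℕ} (p β : Fin n → ℝ) : Prop where
  processing_nonneg : ∀ j, 0 ≤ p j
  fraction_mem : ∀ j, β j ∈ Set.Icc (0 : ℝ) 1

/-- On every instance the algorithm has an execution, and each of its executions is a schedule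
that completes all jobs. -/
def IsWellDefined (A : Algorithm) : Prop :=
  ∀ (n : ℕ) (p β : Fin n → ℝ), IsInstance p β →
    (∃ e, A p β e) ∧ ∀ e, A p β e → IsSchedule p e

/-- `c`-consistency: the competitive ratio is at most `c` if all signals are accurate. -/
def IsConsistent (α : ℝ) (A : Algorithm) (c : ℝ) : Prop :=
  ∀ (n : ℕ) (p β : Fin n → ℝ), IsInstance p β → (∀ j, β j = α) →
    ∀ e, A p β e → totalCompletionTime p e ≤ c * OPT p

/-- `c`-robustness: the competitive ratio is at most `c` for arbitrary signals. -/
def IsRobust (A : Algorithm) (c : ℝ) : Prop :=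
  ∀ (n : ℕ) (p β : Fin n → ℝ), IsInstance p β →
    ∀ e, A p β e → totalCompletionTime p e ≤ c * OPT p

end SignalScheduling

end

/-!
Up to the completion of job `j`, the machine of the algorithm is never idle, so the completion time
of `j` is the sum over all jobs `i` of the delay that `i` causes to `j`, the processing that `i` has
received by then. Hence the cost is determined by the mutual delays of pairs of jobs. In any
schedule two jobs delay each other by at least the smaller of their processing times, which bounds
`OPT` from below by half the sum of these minima over all ordered pairs, counting each diagonal term
twice; so it suffices to bound mutual delays by a multiple of the smaller processing time `p i`.

When job `i` completes, no other job is ahead of it by more than the factor `1 / (α * ρ)` of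
preferential executions; this gives robustness. A job whose signal fraction is at least `α * ρ` is
completed by its preferential execution. If this holds for both `i` and `j`, one of them has not
been served when the other completes, and its delay to the other is then at most `β i * p i`, while
the reverse delay exceeds `p i` at most by a multiple of the errors of the two signals. If one of
the signals comes earlier, its error `|β - α|` exceeds `α - α * ρ` and pays for the robustness
bound.
-/

namespace SignalScheduling

variable {n : ℕ} {α ρ κ K : ℝ} {p β err : Fin n → ℝ} {e : Fin n → ℝ → ℝ} {i j k : Fin n}

/-! ### Functions on a sequence of adjacent intervals -/

theorem monotoneOn_Ici_of_monotoneOn_Icc {R S : Type*} [LinearOrder R] [Preorder S] {τ : ℕ → R}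
    {f : R → S} (hτ : Monotone τ) (hunbdd : ∀ t, ∃ m, t ≤ τ m)
    (hf : ∀ m, MonotoneOn f (Set.Icc (τ m) (τ (m + 1)))) : MonotoneOn f (Set.Ici (τ 0)) := by
  have hIcc (m : ℕ) : MonotoneOn f (Set.Icc (τ 0) (τ m)) := by
    induction m with
    | zero => simp
    | succ m ih =>
      have h₀ : τ 0 ≤ τ m := hτ m.zero_le
      have h₁ : τ m ≤ τ (m + 1) := hτ m.le_succ
      rw [← Set.Icc_union_Icc_eq_Icc h₀ h₁]
      exact ih.union_right (hf m) (isGreatest_Icc h₀) (isLeast_Icc h₁)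
  intro u hu t ht hut
  obtain ⟨m, hm⟩ := hunbdd t
  exact hIcc m ⟨hu, hut.trans hm⟩ ⟨ht, hm⟩ hut

theorem exists_eqOn_Icc_of_eq_at_right {R S : Type*} [LinearOrder R] {τ : ℕ → R} {g : ℕ → R → S}
    (hτ : Monotone τ) (hg : ∀ m, g m (τ (m + 1)) = g (m + 1) (τ (m + 1))) :
    ∃ f : R → S, ∀ m, Set.EqOn f (g m) (Set.Icc (τ m) (τ (m + 1))) := by
  have hoverlap {l m : ℕ} (hlm : l ≤ m) (t : R) (hl : t ≤ τ (l + 1)) (hm : τ m ≤ t) :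
      g l t = g m t := by
    induction m, hlm using Nat.le_induction with
    | base => rfl
    | succ m hlm ih =>
      obtain rfl : t = τ (m + 1) := (hl.trans (hτ (by lia))).antisymm hm
      exact (ih (hτ m.le_succ)).trans (hg m)
  refine ⟨fun t => g (sInf {m | t ≤ τ (m + 1)}) t, fun m t ht => ?_⟩
  have hmem : m ∈ {m | t ≤ τ (m + 1)} := ht.2
  exact hoverlap (Nat.sInf_le hmem) t (Nat.sInf_mem ⟨m, hmem⟩) ht.1

/-! ### Optimal schedules -/

theorem sum_sum_add_swap {ι R : Type*} [Fintype ι] [NonAssocSemiring R] (a : ι → ι → R) :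
    ∑ i, ∑ j, (a i j + a j i) = 2 * ∑ j, ∑ i, a i j := by
  simp only [Finset.sum_add_distrib, two_mul]
  rw [Finset.sum_comm]

theorem completionTime_nonneg (p : Fin n → ℝ) (e : Fin n → ℝ → ℝ) (j : Fin n) :
    0 ≤ completionTime p e j :=
  Real.sInf_nonneg fun _ ht => ht.1

theorem completionTime_le {t : ℝ} (ht : 0 ≤ t) (h : p j ≤ e j t) : completionTime p e j ≤ t :=
  csInf_le ⟨0, fun _ hx => hx.1⟩ ⟨ht, h⟩

theorem IsSchedule.sub_le_sub (h : IsSchedule p e) (j : Fin n) {s t : ℝ} (hs : 0 ≤ s)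
    (hst : s ≤ t) : e j t - e j s ≤ t - s :=
  (Finset.single_le_sum (f := fun i => e i t - e i s)
    (fun i _ => sub_nonneg.2 (h.mono i s t hs hst)) (Finset.mem_univ j)).trans (h.speed s t hs hst)

theorem IsSchedule.nonneg (h : IsSchedule p e) (j : Fin n) {t : ℝ} (ht : 0 ≤ t) : 0 ≤ e j t := by
  simpa only [h.start j] using h.mono j 0 t le_rfl ht

theorem IsSchedule.le_at_completionTime (h : IsSchedule p e) (j : Fin n) :
    p j ≤ e j (completionTime p e j) := by
  refine le_of_forall_pos_le_add fun ε hε => ?_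
  obtain ⟨t, ⟨ht, hpt⟩, htε⟩ := exists_lt_of_csInf_lt (s := {t : ℝ | 0 ≤ t ∧ p j ≤ e j t})
    (h.completes j) (lt_add_of_pos_right (completionTime p e j) hε)
  linarith [h.sub_le_sub j (completionTime_nonneg p e j) (completionTime_le ht hpt)]

theorem IsSchedule.sum_le_completionTime (h : IsSchedule p e) (j : Fin n) :
    ∑ i, e i (completionTime p e j) ≤ completionTime p e j := by
  simpa [h.start] using h.speed 0 _ le_rfl (completionTime_nonneg p e j)

theorem IsSchedule.min_le_at_completionTime_add (h : IsSchedule p e) (i j : Fin n) :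
    min (p i) (p j) ≤ e i (completionTime p e j) + e j (completionTime p e i) := by
  have hi := completionTime_nonneg p e i
  have hj := completionTime_nonneg p e j
  rcases le_total (completionTime p e i) (completionTime p e j) with hij | hji
  · linarith [min_le_left (p i) (p j), h.le_at_completionTime i, h.mono i _ _ hi hij,
      h.nonneg j hi]
  · linarith [min_le_right (p i) (p j), h.le_at_completionTime j, h.mono j _ _ hj hji,
      h.nonneg i hj]

/-- Twice the cost of processing the jobs in the order of their processing times, the `if` being
the second copy of the diagonal: half of it bounds every schedule from below. -/
def pairwiseCost (p : Fin n → ℝ) : ℝ :=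
  ∑ i, ∑ j, (min (p i) (p j) + if i = j then p j else 0)

theorem IsSchedule.pairwiseCost_le (h : IsSchedule p e) :
    pairwiseCost p ≤ 2 * totalCompletionTime p e := by
  calc pairwiseCost p
      ≤ ∑ i, ∑ j, (e i (completionTime p e j) + e j (completionTime p e i)) := by
        refine Finset.sum_le_sum fun i _ => Finset.sum_le_sum fun j _ => ?_
        split_ifs with hij
        · subst hij
          linarith [min_self (p i), h.le_at_completionTime i]
        · linarith [h.min_le_at_completionTime_add i j]
    _ = 2 * ∑ j, ∑ i, e i (completionTime p e j) :=
        sum_sum_add_swap fun i j => e i (completionTime p e j)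
    _ ≤ 2 * totalCompletionTime p e := by
        gcongr
        exact Finset.sum_le_sum fun j _ => h.sum_le_completionTime j

theorem exists_isSchedule (p : Fin n → ℝ) : ∃ e, IsSchedule p e := by
  refine ⟨fun _ t => t / n, fun _ => zero_div _, fun _ s t _ hst => by gcongr, fun s t _ hst => ?_,
    fun j => ?_⟩
  · rcases n.eq_zero_or_pos with rfl | hn
    · simpa using hst
    · simp only [Finset.sum_const, Finset.card_univ, Fintype.card_fin, nsmul_eq_mul]
      field_simp
      exact le_rfl
  · have hn : (0 : ℝ) < n := Nat.cast_pos.2 j.pos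
    refine ⟨max 0 (n * p j), le_max_left _ _, (le_div_iff₀ hn).2 ?_⟩
    rw [mul_comm]
    exact le_max_right _ _

theorem pairwiseCost_le_two_mul_OPT (p : Fin n → ℝ) : pairwiseCost p ≤ 2 * OPT p := by
  rw [mul_comm, ← div_le_iff₀ two_pos]
  obtain ⟨e, he⟩ := exists_isSchedule p
  refine le_csInf ⟨_, e, he, rfl⟩ ?_
  rintro c ⟨e', he', rfl⟩
  rw [div_le_iff₀ two_pos, mul_comm]
  exact he'.pairwiseCost_le

/-- `a i j` is the delay that job `i` causes to job `j`, so the left-hand side is the cost of a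
schedule without idle time. -/
theorem sum_sum_le_mul_OPT_add {a : Fin n → Fin n → ℝ} (hK : 1 ≤ K) (hp : ∀ j, 0 ≤ p j)
    (herr : ∀ j, 0 ≤ err j) (hdiag : ∀ j, a j j ≤ p j)
    (hpair : ∀ i j, i ≠ j → p i ≤ p j → a i j + a j i ≤ K * p i + (err i + err j)) :
    ∑ j, ∑ i, a i j ≤ K * OPT p + n * ∑ i, err i := by
  have hmin (i j : Fin n) : a i j + a j i ≤
      K * (min (p i) (p j) + if i = j then p j else 0) + (err i + err j) := by
    split_ifs with hij
    · subst hij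
      rw [min_self]
      nlinarith [hdiag i, herr i, hp i]
    · rw [add_zero]
      rcases le_total (p i) (p j) with h | h
      · rw [min_eq_left h]
        exact hpair i j hij h
      · rw [min_eq_right h, add_comm, add_comm (err i)]
        exact hpair j i (Ne.symm hij) h
  have htwice : 2 * ∑ j, ∑ i, a i j ≤ K * pairwiseCost p + 2 * (n * ∑ i, err i) := by
    calc 2 * ∑ j, ∑ i, a i j = ∑ i, ∑ j, (a i j + a j i) := (sum_sum_add_swap a).symm
      _ ≤ ∑ i, ∑ j, (K * (min (p i) (p j) + if i = j then p j else 0) + (err i + err j)) :=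
          Finset.sum_le_sum fun i _ => Finset.sum_le_sum fun j _ => hmin i j
      _ = K * pairwiseCost p + ∑ i, ∑ j, (err i + err j) := by
          simp only [pairwiseCost, Finset.sum_add_distrib, Finset.mul_sum, mul_add]
      _ = K * pairwiseCost p + 2 * (n * ∑ i, err i) := by
          rw [sum_sum_add_swap fun i _ => err i]
          simp
  nlinarith [pairwiseCost_le_two_mul_OPT p]

/-! ### Events -/

open Classical in
/-- The uncompleted jobs. -/
noncomputable def unfinished (p : Fin n → ℝ) (s : State n) : Finset (Fin n) :=
  {j | Unfinished p s j}

open Classical in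
/-- The jobs whose signal is still to be emitted; a job served already counts as signaled. -/
noncomputable def unsignaled (p β : Fin n → ℝ) (s : State n) : Finset (Fin n) :=
  {j | j ∉ s.served ∧ s.elapsed j < β j * p j}

/-- The amounts of processing after which a job processed by SETF completes, emits its signal or
catches up with another uncompleted job. -/
def eventAmounts (p β : Fin n → ℝ) (s : State n) : Set ℝ :=
  {x | ∃ j ∈ lowest p s, s.elapsed j + x = p j ∨ (j ∉ s.served ∧ s.elapsed j + x = β j * p j) ∨
    ∃ i, Unfinished p s i ∧ i ∉ lowest p s ∧ s.elapsed j + x = s.elapsed i}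

section Step

variable {s s' : State n} {x : ℝ}

theorem mem_unfinished : j ∈ unfinished p s ↔ Unfinished p s j := by
  simp [unfinished]

theorem mem_unsignaled : j ∈ unsignaled p β s ↔ j ∉ s.served ∧ s.elapsed j < β j * p j := by
  simp [unsignaled]

theorem mem_lowest :
    j ∈ lowest p s ↔ Unfinished p s j ∧ ∀ i, Unfinished p s i → s.elapsed j ≤ s.elapsed i := by
  simp [lowest]

theorem lowest_nonempty (h : ∃ j, Unfinished p s j) : (lowest p s).Nonempty := by
  obtain ⟨j, hj⟩ := h
  obtain ⟨i, hi, hmin⟩ := (unfinished p s).exists_min_image s.elapsed ⟨j, mem_unfinished.2 hj⟩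
  exact ⟨i, mem_lowest.2 ⟨mem_unfinished.1 hi, fun k hk => hmin k (mem_unfinished.2 hk)⟩⟩

theorem elapsed_eq_of_mem_lowest (hi : i ∈ lowest p s) (hj : j ∈ lowest p s) :
    s.elapsed i = s.elapsed j :=
  le_antisymm ((mem_lowest.1 hi).2 j (mem_lowest.1 hj).1)
    ((mem_lowest.1 hj).2 i (mem_lowest.1 hi).1)

theorem eventAmounts_finite (p β : Fin n → ℝ) (s : State n) : (eventAmounts p β s).Finite := by
  refine ((Set.finite_range fun j => p j - s.elapsed j).union <|
    (Set.finite_range fun j => β j * p j - s.elapsed j).union <|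
    Set.finite_range fun q : Fin n × Fin n => s.elapsed q.1 - s.elapsed q.2).subset ?_
  rintro x ⟨j, -, h | ⟨-, h⟩ | ⟨i, -, -, h⟩⟩
  · exact .inl ⟨j, sub_eq_of_eq_add' h.symm⟩
  · exact .inr (.inl ⟨j, sub_eq_of_eq_add' h.symm⟩)
  · exact .inr (.inr ⟨(i, j), sub_eq_of_eq_add' h.symm⟩)

theorem exists_isLeast_eventAmounts (β : Fin n → ℝ) (h : ∃ j, Unfinished p s j) :
    ∃ x, IsLeast (eventAmounts p β s) x := by
  obtain ⟨j, hj⟩ := lowest_nonempty h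
  exact Set.exists_min_image _ id (eventAmounts_finite p β s)
    ⟨p j - s.elapsed j, j, hj, .inl (add_sub_cancel _ _)⟩

theorem noEventBefore_iff :
    NoEventBefore p β s x ↔ 0 ≤ x ∧ x ∈ lowerBounds (eventAmounts p β s) := by
  refine and_congr_right fun _ => ⟨?_, fun h j hj => ⟨?_, fun hs => ?_, fun i hi hil => ?_⟩⟩
  · rintro h y ⟨j, hj, hy | ⟨hs, hy⟩ | ⟨i, hi, hil, hy⟩⟩
    · linarith [(h j hj).1]
    · linarith [(h j hj).2.1 hs]
    · linarith [(h j hj).2.2 i hi hil]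
  · linarith [h ⟨j, hj, .inl (add_sub_cancel (s.elapsed j) (p j))⟩]
  · linarith [h ⟨j, hj, .inr (.inl ⟨hs, add_sub_cancel (s.elapsed j) (β j * p j)⟩)⟩]
  · linarith [h ⟨j, hj, .inr (.inr ⟨i, hi, hil, add_sub_cancel (s.elapsed j) (s.elapsed i)⟩)⟩]

theorem nonneg_of_mem_eventAmounts (hp : ∀ j, ¬ Pending p β s j) (hx : x ∈ eventAmounts p β s) :
    0 ≤ x := by
  obtain ⟨j, hj, h | ⟨hs, h⟩ | ⟨i, hi, -, h⟩⟩ := hx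
  · have : s.elapsed j < p j := (mem_lowest.1 hj).1
    linarith
  · have : s.elapsed j < β j * p j := lt_of_not_ge fun hβ => hp j ⟨(mem_lowest.1 hj).1, hβ, hs⟩
    linarith
  · linarith [(mem_lowest.1 hj).2 i hi]

theorem isGreatest_noEventBefore (hp : ∀ j, ¬ Pending p β s j)
    (hx : IsLeast (eventAmounts p β s) x) : IsGreatest {y | NoEventBefore p β s y} x :=
  ⟨noEventBefore_iff.2 ⟨nonneg_of_mem_eventAmounts hp hx.1, hx.2⟩,
    fun _ hy => (noEventBefore_iff.1 hy).2 hx.1⟩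

theorem mem_eventAmounts_of_isGreatest (hp : ∀ j, ¬ Pending p β s j) (hu : ∃ j, Unfinished p s j)
    (hx : IsGreatest {y | NoEventBefore p β s y} x) : x ∈ eventAmounts p β s := by
  obtain ⟨y, hy⟩ := exists_isLeast_eventAmounts β hu
  exact hx.unique (isGreatest_noEventBefore hp hy) ▸ hy.1

theorem exists_phase (α ρ : ℝ) (p β : Fin n → ℝ) (s : State n) :
    ∃ d r S, Phase α ρ p β s d r S := by
  by_cases hu : ∃ j, Unfinished p s j
  · by_cases hp : ∃ j, Pending p β s j
    · obtain ⟨j, hj⟩ := hp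
      exact ⟨_, _, _, .prefer j hj⟩
    · obtain ⟨x, hx⟩ := exists_isLeast_eventAmounts β hu
      have hp := not_exists.1 hp
      exact ⟨_, _, _, .setf x hp hu (isGreatest_noEventBefore hp hx)⟩
  · exact ⟨_, _, _, .idle (not_exists.1 hu)⟩

/-! ### Steps -/

/-- The state after the preferential execution of job `j`, where `κ` is `α * ρ`. -/
noncomputable def State.prefer (κ : ℝ) (p : Fin n → ℝ) (s : State n) (j : Fin n) : State n where
  time := s.time + (min (s.elapsed j / κ) (p j) - s.elapsed j)
  elapsed := Function.update s.elapsed j (min (s.elapsed j / κ) (p j))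
  served := insert j s.served

/-- The state after SETF has given a further amount `x` to each job that it processes. -/
noncomputable def State.setf (p : Fin n → ℝ) (s : State n) (x : ℝ) : State n where
  time := s.time + (lowest p s).card * x
  elapsed i := if i ∈ lowest p s then s.elapsed i + x else s.elapsed i
  served := s.served

/-- The effect of a `Phase` on the state. It depends on `α` and `ρ` only through their product
`κ`. -/
inductive Step (κ : ℝ) (p β : Fin n → ℝ) (s : State n) : State n → Prop
  | prefer (j : Fin n) (hj : Pending p β s j) : Step κ p β s (s.prefer κ p j)
  | setf (x : ℝ) (hp : ∀ j, ¬ Pending p β s j) (hu : ∃ j, Unfinished p s j)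
      (hx : NoEventBefore p β s x) (hevent : x ∈ eventAmounts p β s) : Step κ p β s (s.setf p x)
  | idle (hu : ∀ j, ¬ Unfinished p s j) : Step κ p β s { s with time := s.time + 1 }

theorem prefer_elapsed_self : (s.prefer κ p j).elapsed j = min (s.elapsed j / κ) (p j) :=
  Function.update_self ..

theorem prefer_elapsed_of_ne (h : i ≠ j) : (s.prefer κ p j).elapsed i = s.elapsed i :=
  Function.update_of_ne h ..

theorem notMem_served_prefer : i ∉ (s.prefer κ p j).served ↔ i ≠ j ∧ i ∉ s.served := by
  simp [State.prefer]

theorem setf_elapsed_of_mem (h : i ∈ lowest p s) : (s.setf p x).elapsed i = s.elapsed i + x :=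
  if_pos h

theorem setf_elapsed_of_notMem (h : i ∉ lowest p s) : (s.setf p x).elapsed i = s.elapsed i :=
  if_neg h

theorem NoEventBefore.setf_elapsed_le (hx : NoEventBefore p β s x) (hi : Unfinished p s i)
    (hj : j ∈ lowest p s) : (s.setf p x).elapsed j ≤ (s.setf p x).elapsed i := by
  rw [setf_elapsed_of_mem hj]
  by_cases hil : i ∈ lowest p s
  · rw [setf_elapsed_of_mem hil, elapsed_eq_of_mem_lowest hj hil]
  · rw [setf_elapsed_of_notMem hil]
    exact (hx.2 j hj).2.2 i hi hil

theorem Phase.step {d : ℝ} {r : Fin n → ℝ} (h : Phase α ρ p β s d r s'.served)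
    (ht : s'.time = s.time + d) (he : ∀ j, s'.elapsed j = s.elapsed j + d * r j) :
    Step (α * ρ) p β s s' := by
  obtain ⟨t', e', S'⟩ := s'
  obtain rfl : t' = s.time + d := ht
  obtain rfl : e' = fun j => s.elapsed j + d * r j := funext he
  cases h with
  | prefer j hj =>
    convert Step.prefer (κ := α * ρ) j hj using 1
    have hd : min ((1 / (α * ρ) - 1) * s.elapsed j) (p j - s.elapsed j) =
        min (s.elapsed j / (α * ρ)) (p j) - s.elapsed j := by
      rw [← min_sub_sub_right]
      ring_nf
    simp only [State.prefer, State.mk.injEq, hd, true_and]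
    refine ⟨funext fun i => ?_, rfl⟩
    by_cases hi : i = j
    · subst hi
      simp
    · simp [hi]
  | setf x hp hu hx =>
    convert Step.setf (κ := α * ρ) x hp hu hx.1 (mem_eventAmounts_of_isGreatest hp hu hx) using 1
    have hcard : ((lowest p s).card : ℝ) ≠ 0 := mod_cast (lowest_nonempty hu).card_ne_zero
    simp only [State.setf, State.mk.injEq, true_and, and_true]
    ext i
    split_ifs
    · field_simp
    · ring
  | idle hu => simpa using Step.idle (κ := α * ρ) hu

theorem Phase.rate_nonneg {d : ℝ} {r : Fin n → ℝ} {S : Finset (Fin n)}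
    (h : Phase α ρ p β s d r S) (j : Fin n) : 0 ≤ r j := by
  cases h with
  | prefer _ _ => dsimp only; split_ifs <;> norm_num
  | setf _ _ _ _ => dsimp only; split_ifs <;> positivity
  | idle _ => exact le_rfl

theorem Phase.sum_rate_le_one {d : ℝ} {r : Fin n → ℝ} {S : Finset (Fin n)}
    (h : Phase α ρ p β s d r S) : ∑ j, r j ≤ 1 := by
  cases h with
  | prefer _ _ => simp
  | setf _ _ hu _ =>
    have hcard : ((lowest p s).card : ℝ) ≠ 0 := mod_cast (lowest_nonempty hu).card_ne_zero
    simp [Finset.sum_ite_mem, hcard]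
  | idle _ => simp

theorem Step.served_subset (h : Step κ p β s s') : s.served ⊆ s'.served := by
  cases h with
  | prefer j _ => exact Finset.subset_insert j s.served
  | setf _ _ _ _ _ => exact subset_rfl
  | idle _ => exact subset_rfl

theorem Step.eq_of_newly_served (h : Step κ p β s s') (hi : i ∉ s.served) (hj : j ∉ s.served)
    (hi' : i ∈ s'.served) (hj' : j ∈ s'.served) : i = j := by
  cases h with
  | prefer k _ =>
    rw [(Finset.mem_insert.1 hi').resolve_right hi, (Finset.mem_insert.1 hj').resolve_right hj]
  | setf _ _ _ _ _ => exact absurd hi' hi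
  | idle _ => exact absurd hi' hi

theorem Step.time_of_finished (h : Step κ p β s s') (hu : ∀ j, ¬ Unfinished p s j) :
    s'.time = s.time + 1 := by
  cases h with
  | prefer j hj => exact absurd hj.1 (hu j)
  | setf _ _ hu' _ _ => exact absurd hu' (not_exists.2 hu)
  | idle _ => rfl

theorem Step.time_sub_time (h : Step κ p β s s') (hu : ∃ j, Unfinished p s j) :
    s'.time - s.time = ∑ j, (s'.elapsed j - s.elapsed j) := by
  cases h with
  | prefer j _ =>
    rw [Finset.sum_eq_single j (fun i _ hi => by rw [prefer_elapsed_of_ne hi, sub_self]) (by simp),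
      prefer_elapsed_self]
    exact add_sub_cancel_left _ _
  | setf x _ _ _ _ =>
    have hdiff (i : Fin n) : (s.setf p x).elapsed i - s.elapsed i =
        if i ∈ lowest p s then x else 0 := by
      simp only [State.setf]
      split_ifs <;> ring
    simp only [hdiff, Finset.sum_ite_mem, Finset.univ_inter, Finset.sum_const, nsmul_eq_mul]
    exact add_sub_cancel_left _ _
  | idle hall => exact absurd hu (not_exists.2 hall)

/-! ### Invariants -/

/-- The invariant of all states of a run. The last field says that a job served is completed by
its preferential execution, unless its signal came early. -/
structure Sound (κ : ℝ) (p β : Fin n → ℝ) (s : State n) : Prop where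
  nonneg : ∀ j, 0 ≤ s.elapsed j
  le : ∀ j, s.elapsed j ≤ p j
  le_signal : ∀ j, j ∉ s.served → s.elapsed j ≤ β j * p j
  finished : ∀ j, κ ≤ β j → j ∈ s.served → p j ≤ s.elapsed j

theorem Sound.init (h : IsInstance p β) : Sound κ p β (State.init n) where
  nonneg _ := le_rfl
  le := h.processing_nonneg
  le_signal j _ := mul_nonneg (h.fraction_mem j).1 (h.processing_nonneg j)
  finished j _ hj := absurd hj (Finset.notMem_empty j)

theorem Sound.elapsed_mono (hκ : 0 < κ) (hκ1 : κ ≤ 1) (hs : Sound κ p β s)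
    (h : Step κ p β s s') (i : Fin n) : s.elapsed i ≤ s'.elapsed i := by
  cases h with
  | prefer j _ =>
    by_cases hi : i = j
    · subst hi
      rw [prefer_elapsed_self]
      exact le_min (le_div_self (hs.nonneg i) hκ hκ1) (hs.le i)
    · exact (prefer_elapsed_of_ne hi).ge
  | setf x _ _ hx _ =>
    by_cases hi : i ∈ lowest p s
    · rw [setf_elapsed_of_mem hi]
      exact le_add_of_nonneg_right hx.1
    · exact (setf_elapsed_of_notMem hi).ge
  | idle _ => exact le_rfl

theorem Sound.time_mono (hκ : 0 < κ) (hκ1 : κ ≤ 1) (hs : Sound κ p β s)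
    (h : Step κ p β s s') : s.time ≤ s'.time := by
  by_cases hu : ∃ j, Unfinished p s j
  · rw [← sub_nonneg, h.time_sub_time hu]
    exact Finset.sum_nonneg fun j _ => sub_nonneg.2 (hs.elapsed_mono hκ hκ1 h j)
  · linarith [h.time_of_finished (not_exists.1 hu)]

theorem Sound.step (hκ : 0 < κ) (hκ1 : κ ≤ 1) (hs : Sound κ p β s) (h : Step κ p β s s') :
    Sound κ p β s' := by
  have hmono := hs.elapsed_mono hκ hκ1 h
  have hnonneg (i : Fin n) : 0 ≤ s'.elapsed i := (hs.nonneg i).trans (hmono i)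
  cases h with
  | prefer j hj =>
    refine ⟨hnonneg, fun i => ?_, fun i hi => ?_, fun i hβ hi => ?_⟩
    · by_cases hij : i = j
      · subst hij
        exact prefer_elapsed_self.trans_le (min_le_right _ _)
      · exact (prefer_elapsed_of_ne hij).trans_le (hs.le i)
    · obtain ⟨hij, hi⟩ := notMem_served_prefer.1 hi
      exact (prefer_elapsed_of_ne hij).trans_le (hs.le_signal i hi)
    · rcases Finset.mem_insert.1 hi with rfl | hi
      · have hp : 0 ≤ p i := (hs.nonneg i).trans (hs.le i)
        rw [prefer_elapsed_self]
        refine le_min ((le_div_iff₀' hκ).2 ?_) le_rfl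
        exact (mul_le_mul_of_nonneg_right hβ hp).trans hj.2.1
      · exact (hs.finished i hβ hi).trans (hmono i)
  | setf x _ _ hx _ =>
    refine ⟨hnonneg, fun i => ?_, fun i hi => ?_, fun i hβ hi => ?_⟩
    · by_cases hil : i ∈ lowest p s
      · exact (setf_elapsed_of_mem hil).trans_le (hx.2 i hil).1
      · exact (setf_elapsed_of_notMem hil).trans_le (hs.le i)
    · by_cases hil : i ∈ lowest p s
      · exact (setf_elapsed_of_mem hil).trans_le ((hx.2 i hil).2.1 hi)
      · exact (setf_elapsed_of_notMem hil).trans_le (hs.le_signal i hi)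
    · exact (hs.finished i hβ hi).trans (hmono i)
  | idle _ => exact ⟨hs.nonneg, hs.le, hs.le_signal, hs.finished⟩

theorem Sound.notMem_served (hs : Sound κ p β s) (hβ : κ ≤ β i) (hi : Unfinished p s i) :
    i ∉ s.served :=
  fun hmem => (hs.finished i hβ hmem).not_gt hi

/-- The invariant of the states up to the completion of job `i`: a job can be ahead of `i` only
after its preferential execution, and then only by the factor `1 / κ`. -/
structure Leads (κ : ℝ) (i : Fin n) (s : State n) : Prop where
  le_of_unserved : ∀ j, j ∉ s.served → s.elapsed j ≤ s.elapsed i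
  mul_le : ∀ j, κ * s.elapsed j ≤ s.elapsed i

theorem Leads.init (κ : ℝ) (i : Fin n) : Leads κ i (State.init n) where
  le_of_unserved _ _ := le_rfl
  mul_le _ := (mul_zero κ).le

theorem Leads.step (hκ : 0 < κ) (hκ1 : κ ≤ 1) (hs : Sound κ p β s) (hi : Unfinished p s i)
    (hl : Leads κ i s) (h : Step κ p β s s') : Leads κ i s' := by
  have hmono := hs.elapsed_mono hκ hκ1 h i
  have hs' := hs.step hκ hκ1 h
  cases h with
  | prefer k hk =>
    refine ⟨fun j hj => ?_, fun j => ?_⟩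
    · obtain ⟨hjk, hj⟩ := notMem_served_prefer.1 hj
      exact (prefer_elapsed_of_ne hjk).trans_le ((hl.le_of_unserved j hj).trans hmono)
    · by_cases hjk : j = k
      · subst hjk
        have hle : (s.prefer κ p j).elapsed j ≤ s.elapsed j / κ :=
          prefer_elapsed_self.trans_le (min_le_left _ _)
        exact ((le_div_iff₀' hκ).1 hle).trans ((hl.le_of_unserved j hk.2.2).trans hmono)
      · rw [prefer_elapsed_of_ne hjk]
        exact (hl.mul_le j).trans hmono
  | setf x _ _ hx _ =>
    refine ⟨fun j hj => ?_, fun j => ?_⟩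
    · by_cases hjl : j ∈ lowest p s
      · exact hx.setf_elapsed_le hi hjl
      · rw [setf_elapsed_of_notMem hjl]
        exact (hl.le_of_unserved j hj).trans hmono
    · by_cases hjl : j ∈ lowest p s
      · exact (mul_le_of_le_one_left (hs'.nonneg j) hκ1).trans (hx.setf_elapsed_le hi hjl)
      · rw [setf_elapsed_of_notMem hjl]
        exact (hl.mul_le j).trans hmono
  | idle hu => exact absurd hi (hu i)

/-- The invariant of the states up to the completion of a job `i` whose signal is not early: no
other job passes the level at which `i` emits its signal, unless its own signal is below it. -/
structure SignalLeads (p β : Fin n → ℝ) (i : Fin n) (s : State n) : Prop where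
  le_signal : ∀ j, j ∉ s.served → s.elapsed j ≤ β i * p i
  signal_le_signal : ∀ j, j ∈ s.served → β j * p j ≤ β i * p i

theorem SignalLeads.init (h : IsInstance p β) (i : Fin n) : SignalLeads p β i (State.init n) where
  le_signal _ _ := mul_nonneg (h.fraction_mem i).1 (h.processing_nonneg i)
  signal_le_signal j hj := absurd hj (Finset.notMem_empty j)

theorem SignalLeads.step (hs' : Sound κ p β s') (hl' : Leads κ i s') (hi : i ∉ s.served)
    (hl : SignalLeads p β i s) (h : Step κ p β s s') : SignalLeads p β i s' := by
  cases h with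
  | prefer k hk =>
    refine ⟨fun j hj => ?_, fun j hj => ?_⟩
    · obtain ⟨hjk, hj⟩ := notMem_served_prefer.1 hj
      exact (prefer_elapsed_of_ne hjk).trans_le (hl.le_signal j hj)
    · rcases Finset.mem_insert.1 hj with rfl | hj
      · exact hk.2.1.trans (hl.le_signal j hk.2.2)
      · exact hl.signal_le_signal j hj
  | setf x _ _ hx _ =>
    exact ⟨fun j hj => (hl'.le_of_unserved j hj).trans (hs'.le_signal i hi), hl.signal_le_signal⟩
  | idle hu => exact ⟨hl.le_signal, hl.signal_le_signal⟩

/-! ### Termination -/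

/-- A quantity that decreases in every step until all jobs are completed: a step removes a job
from one of the first three sets or, when SETF catches up with a job, from the last one. -/
noncomputable def potential (p β : Fin n → ℝ) (s : State n) :
    (Finset (Fin n) × Finset (Fin n) × Finset (Fin n)) ×ₗ Finset (Fin n) :=
  toLex ((unfinished p s, s.servedᶜ, unsignaled p β s), unfinished p s \ lowest p s)

theorem notMem_unfinished_setf (hj : j ∈ lowest p s) (h : s.elapsed j + x = p j) :
    j ∉ unfinished p (s.setf p x) := by
  rw [mem_unfinished, Unfinished, setf_elapsed_of_mem hj, h]
  exact lt_irrefl _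

theorem unfinished_sdiff_lowest_setf_ssubset (hx : NoEventBefore p β s x)
    (hu : unfinished p (s.setf p x) = unfinished p s) (hj : j ∈ lowest p s)
    (hi : Unfinished p s i) (hil : i ∉ lowest p s) (h : s.elapsed j + x = s.elapsed i) :
    unfinished p (s.setf p x) \ lowest p (s.setf p x) ⊂ unfinished p s \ lowest p s := by
  have hiff (k : Fin n) : Unfinished p (s.setf p x) k ↔ Unfinished p s k := by
    rw [← mem_unfinished, hu, mem_unfinished]
  have hlowest {k : Fin n} (hk : k ∈ lowest p s) : k ∈ lowest p (s.setf p x) :=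
    mem_lowest.2 ⟨(hiff k).2 (mem_lowest.1 hk).1, fun l hl => hx.setf_elapsed_le ((hiff l).1 hl) hk⟩
  have hi' : i ∈ lowest p (s.setf p x) := by
    refine mem_lowest.2 ⟨(hiff i).2 hi, fun l hl => ?_⟩
    rw [setf_elapsed_of_notMem hil, ← h, ← setf_elapsed_of_mem hj]
    exact hx.setf_elapsed_le ((hiff l).1 hl) hj
  rw [hu]
  refine (Finset.ssubset_iff_of_subset (Finset.sdiff_subset_sdiff subset_rfl fun k => hlowest)).2
    ⟨i, Finset.mem_sdiff.2 ⟨mem_unfinished.2 hi, hil⟩, fun hmem => ?_⟩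
  exact (Finset.mem_sdiff.1 hmem).2 hi'

theorem Sound.potential_lt (hκ : 0 < κ) (hκ1 : κ ≤ 1) (hs : Sound κ p β s)
    (h : Step κ p β s s') (hu : ∃ j, Unfinished p s j) : potential p β s' < potential p β s := by
  have hmono := hs.elapsed_mono hκ hκ1 h
  have hunfinished : unfinished p s' ⊆ unfinished p s := fun j hj =>
    mem_unfinished.2 ((hmono j).trans_lt (mem_unfinished.1 hj))
  have hserved : s'.servedᶜ ⊆ s.servedᶜ := Finset.compl_subset_compl.2 h.served_subset
  have hunsignaled : unsignaled p β s' ⊆ unsignaled p β s := fun j hj => by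
    obtain ⟨hj, hβ⟩ := mem_unsignaled.1 hj
    exact mem_unsignaled.2 ⟨fun hmem => hj (h.served_subset hmem), (hmono j).trans_lt hβ⟩
  refine Prod.Lex.toLex_lt_toLex'.2 ⟨⟨hunfinished, hserved, hunsignaled⟩, fun heq => ?_⟩
  simp only [Prod.mk.injEq, compl_inj_iff] at heq
  obtain ⟨hunfinished, hserved, hunsignaled⟩ := heq
  cases h with
  | prefer j hj => exact absurd (hserved ▸ Finset.mem_insert_self j s.served) hj.2.2
  | setf x hp _ hx hevent =>
    obtain ⟨j, hj, h | ⟨hjs, h⟩ | ⟨i, hi, hil, h⟩⟩ := hevent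
    · exact absurd (hunfinished ▸ mem_unfinished.2 (mem_lowest.1 hj).1)
        (notMem_unfinished_setf hj h)
    · have hmem : j ∈ unsignaled p β s := mem_unsignaled.2
        ⟨hjs, lt_of_not_ge fun hβ => hp j ⟨(mem_lowest.1 hj).1, hβ, hjs⟩⟩
      rw [← hunsignaled, mem_unsignaled, setf_elapsed_of_mem hj] at hmem
      exact absurd h hmem.2.ne
    · exact unfinished_sdiff_lowest_setf_ssubset hx hunfinished hj hi hil h
  | idle hall => exact absurd hu (not_exists.2 hall)

end Step

/-! ### Runs -/

/-- A sequence of states that the algorithm with parameter `κ ∈ (0, 1]` may pass through on the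
instance `(p, β)`. -/
structure IsRun (κ : ℝ) (p β : Fin n → ℝ) (s : ℕ → State n) : Prop where
  pos : 0 < κ
  le_one : κ ≤ 1
  isInstance : IsInstance p β
  start : s 0 = State.init n
  step : ∀ m, Step κ p β (s m) (s (m + 1))

/-- The index of the first state in which job `j` is completed. -/
noncomputable def finishIndex (p : Fin n → ℝ) (s : ℕ → State n) (j : Fin n) : ℕ :=
  sInf {m | ¬ Unfinished p (s m) j}

/-- The delay that job `i` causes to job `j`: the processing that `i` has received when `j`
completes. -/
noncomputable def delay (p : Fin n → ℝ) (s : ℕ → State n) (i j : Fin n) : ℝ :=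
  (s (finishIndex p s j)).elapsed i

section Run

variable {s : ℕ → State n} {m : ℕ}

theorem unfinished_of_lt_finishIndex (h : m < finishIndex p s j) : Unfinished p (s m) j :=
  not_not.1 (Nat.notMem_of_lt_sInf h)

theorem finishIndex_le (h : ¬ Unfinished p (s m) j) : finishIndex p s j ≤ m :=
  Nat.sInf_le h

namespace IsRun

theorem sound (h : IsRun κ p β s) (m : ℕ) : Sound κ p β (s m) := by
  induction m with
  | zero => exact h.start ▸ Sound.init h.isInstance
  | succ m ih => exact ih.step h.pos h.le_one (h.step m)

theorem time_mono (h : IsRun κ p β s) : Monotone fun m => (s m).time :=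
  monotone_nat_of_le_succ fun m => (h.sound m).time_mono h.pos h.le_one (h.step m)

theorem time_zero (h : IsRun κ p β s) : (s 0).time = 0 := by
  rw [h.start, State.init]

theorem time_nonneg (h : IsRun κ p β s) (m : ℕ) : 0 ≤ (s m).time :=
  h.time_zero.ge.trans (h.time_mono m.zero_le)

theorem elapsed_mono (h : IsRun κ p β s) (j : Fin n) : Monotone fun m => (s m).elapsed j :=
  monotone_nat_of_le_succ fun m => (h.sound m).elapsed_mono h.pos h.le_one (h.step m) j

theorem exists_all_finished (h : IsRun κ p β s) : ∃ m, ∀ j, ¬ Unfinished p (s m) j := by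
  by_contra! hu
  exact not_strictAnti_of_wellFoundedLT (fun m => potential p β (s m)) <|
    strictAnti_nat_of_succ_lt fun m => (h.sound m).potential_lt h.pos h.le_one (h.step m) (hu m)

theorem exists_le_time (h : IsRun κ p β s) (t : ℝ) : ∃ m, t ≤ (s m).time := by
  obtain ⟨N, hN⟩ := h.exists_all_finished
  have hfinished (k : ℕ) (j : Fin n) : ¬ Unfinished p (s (N + k)) j := fun hj =>
    hN j ((h.elapsed_mono j (N.le_add_right k)).trans_lt hj)
  have htime (k : ℕ) : (s (N + k)).time = (s N).time + k := by
    induction k with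
    | zero => simp
    | succ k ih =>
      rw [← add_assoc, (h.step (N + k)).time_of_finished (hfinished k), ih]
      push_cast
      ring
  obtain ⟨k, hk⟩ := exists_nat_ge (t - (s N).time)
  exact ⟨N + k, by linarith [htime k]⟩

theorem le_elapsed_finishIndex (h : IsRun κ p β s) (j : Fin n) :
    p j ≤ (s (finishIndex p s j)).elapsed j := by
  obtain ⟨m, hm⟩ := h.exists_all_finished
  exact not_lt.1 (Nat.sInf_mem (s := {m | ¬ Unfinished p (s m) j}) ⟨m, hm j⟩)

theorem time_eq_sum_elapsed (h : IsRun κ p β s) (hm : m ≤ finishIndex p s j) :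
    (s m).time = ∑ i, (s m).elapsed i := by
  induction m with
  | zero => simp [h.start, State.init]
  | succ m ih =>
    have hstep := (h.step m).time_sub_time ⟨j, unfinished_of_lt_finishIndex hm⟩
    rw [Finset.sum_sub_distrib] at hstep
    linarith [ih (Nat.le_of_succ_le hm)]

theorem leads (h : IsRun κ p β s) (hm : m ≤ finishIndex p s i) : Leads κ i (s m) := by
  induction m with
  | zero => exact h.start ▸ Leads.init κ i
  | succ m ih =>
    exact (ih (Nat.le_of_succ_le hm)).step h.pos h.le_one (h.sound m)
      (unfinished_of_lt_finishIndex hm) (h.step m)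

theorem signalLeads (h : IsRun κ p β s) (hβ : κ ≤ β i) (hm : m ≤ finishIndex p s i) :
    SignalLeads p β i (s m) := by
  induction m with
  | zero => exact h.start ▸ SignalLeads.init h.isInstance i
  | succ m ih =>
    have hi : i ∉ (s m).served := (h.sound m).notMem_served hβ (unfinished_of_lt_finishIndex hm)
    exact (ih (Nat.le_of_succ_le hm)).step (h.sound (m + 1)) (h.leads hm) hi (h.step m)

theorem finishIndex_le_of_mem_served (h : IsRun κ p β s) (hβ : κ ≤ β j)
    (hj : j ∈ (s m).served) : finishIndex p s j ≤ m :=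
  finishIndex_le fun hu => (h.sound m).notMem_served hβ hu hj

theorem notMem_served_finishIndex (h : IsRun κ p β s) (hij : i ≠ j) (hi : κ ≤ β i)
    (hj : κ ≤ β j) (hserved : j ∈ (s (finishIndex p s i)).served) :
    i ∉ (s (finishIndex p s j)).served := by
  intro hserved'
  have heq : finishIndex p s j = finishIndex p s i :=
    (h.finishIndex_le_of_mem_served hj hserved).antisymm
      (h.finishIndex_le_of_mem_served hi hserved')
  rw [heq] at hserved'
  rcases hM : finishIndex p s i with _ | M
  · rw [hM, h.start] at hserved
    exact absurd hserved (Finset.notMem_empty j)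
  · have hunserved {k : Fin n} (hk : κ ≤ β k) (hlt : M < finishIndex p s k) :
        k ∉ (s M).served :=
      fun hmem => (h.finishIndex_le_of_mem_served hk hmem).not_gt hlt
    rw [hM] at hserved hserved'
    exact hij <| (h.step M).eq_of_newly_served (hunserved hi (by lia)) (hunserved hj (by lia))
      hserved' hserved

theorem delay_le (h : IsRun κ p β s) (i j : Fin n) : delay p s i j ≤ p i :=
  (h.sound _).le i

theorem mutual_delay_le (h : IsRun κ p β s) (i j : Fin n) :
    delay p s i j + delay p s j i ≤ (1 + 1 / κ) * p i := by
  have hji : delay p s j i ≤ p i / κ :=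
    (le_div_iff₀' h.pos).2 (((h.leads le_rfl).mul_le j).trans (h.delay_le i i))
  calc delay p s i j + delay p s j i ≤ p i + p i / κ := add_le_add (h.delay_le i j) hji
    _ = (1 + 1 / κ) * p i := by ring

end IsRun

end Run

/-! ### Prediction errors -/

/-- The error of the signal of job `j`, weighted by the processing time. -/
def signalError (α : ℝ) (p β : Fin n → ℝ) (j : Fin n) : ℝ :=
  |β j - α| * p j

theorem IsInstance.signalError_nonneg (h : IsInstance p β) (α : ℝ) (j : Fin n) :
    0 ≤ signalError α p β j :=
  mul_nonneg (abs_nonneg _) (h.processing_nonneg j)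

theorem IsInstance.abs_sub_le_signalError (h : IsInstance p β) (α : ℝ) (j : Fin n) :
    |β j * p j - α * p j| ≤ signalError α p β j := by
  rw [← sub_mul, abs_mul, abs_of_nonneg (h.processing_nonneg j), signalError]

theorem one_div_mul_le_of_early_signal {b q q' : ℝ} (hκ : 0 < κ) (hκα : κ < α) (hq : 0 ≤ q)
    (hqq' : q ≤ q') (hb : b < κ) : 1 / κ * q ≤ 1 / (κ * (α - κ)) * (|b - α| * q') := by
  have hακ : 0 < α - κ := sub_pos.2 hκα
  have habs : α - κ ≤ |b - α| := by
    rw [abs_sub_comm]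
    exact (sub_le_sub_left hb.le α).trans (le_abs_self _)
  calc 1 / κ * q = 1 / (κ * (α - κ)) * ((α - κ) * q) := by field_simp
    _ ≤ 1 / (κ * (α - κ)) * (|b - α| * q') := by gcongr

theorem IsRun.mutual_delay_le_of_signal {s : ℕ → State n} (h : IsRun κ p β s) (hα : 0 < α)
    (hα1 : α ≤ 1) (hij : i ≠ j) (hi : κ ≤ β i) (hj : κ ≤ β j) :
    delay p s i j + delay p s j i ≤
      (1 + α) * p i + 2 * (1 / α) * (signalError α p β i + signalError α p β j) := by
  have hηi := (abs_le.1 (h.isInstance.abs_sub_le_signalError α i)).2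
  have hηj := (abs_le.1 (h.isInstance.abs_sub_le_signalError α j)).1
  have hη : 0 ≤ signalError α p β i + signalError α p β j :=
    add_nonneg (h.isInstance.signalError_nonneg α i) (h.isInstance.signalError_nonneg α j)
  have hηα := le_div_self hη hα hα1
  rw [mul_assoc, one_div_mul_eq_div]
  by_cases hserved : j ∈ (s (finishIndex p s i)).served
  · have hij' : delay p s i j ≤ β i * p i :=
      (h.sound _).le_signal i (h.notMem_served_finishIndex hij hi hj hserved)
    have hsignal : β j * p j ≤ β i * p i := (h.signalLeads hi le_rfl).signal_le_signal j hserved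
    have hp : p j - p i ≤ (signalError α p β i + signalError α p β j) / α := by
      rw [le_div_iff₀ hα]
      linarith
    linarith [h.delay_le j i, h.isInstance.signalError_nonneg α j]
  · have hji : delay p s j i ≤ β i * p i := (h.signalLeads hi le_rfl).le_signal j hserved
    linarith [h.delay_le i j, h.isInstance.signalError_nonneg α j]

theorem IsRun.mutual_delay_le_signalError {s : ℕ → State n} (h : IsRun κ p β s) (hκα : κ < α)
    (hα1 : α ≤ 1) (hij : i ≠ j) (hp : p i ≤ p j) :
    delay p s i j + delay p s j i ≤ (1 + α) * p i +
      2 * (1 / (κ * (α - κ))) * (signalError α p β i + signalError α p β j) := by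
  have hα : 0 < α := h.pos.trans hκα
  have : 0 < α - κ := sub_pos.2 hκα
  have hκ := h.pos
  have hpi := h.isInstance.processing_nonneg i
  have hηi := h.isInstance.signalError_nonneg α i
  have hηj := h.isInstance.signalError_nonneg α j
  have hearly (k : Fin n) (hk : p i ≤ p k) (hβ : β k < κ) :
      1 / κ * p i ≤ 1 / (κ * (α - κ)) * signalError α p β k :=
    one_div_mul_le_of_early_signal hκ hκα hpi hk hβ
  have hci : 0 ≤ 1 / (κ * (α - κ)) * signalError α p β i := by positivity
  have hcj : 0 ≤ 1 / (κ * (α - κ)) * signalError α p β j := by positivity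
  rcases lt_or_ge (β i) κ with hi | hi
  · linarith [h.mutual_delay_le i j, hearly i le_rfl hi, mul_nonneg hα.le hpi]
  rcases lt_or_ge (β j) κ with hj | hj
  · linarith [h.mutual_delay_le i j, hearly j hp hj, mul_nonneg hα.le hpi]
  · have hle : κ * (α - κ) ≤ α := by nlinarith
    refine (h.mutual_delay_le_of_signal hα hα1 hij hi hj).trans ?_
    gcongr

/-! ### Executions -/

/-- A sequence of phases, of durations `d` and with rates `r`, that the algorithm may perform,
together with the states `s` between them. -/
structure IsPhaseSequence (α ρ : ℝ) (p β : Fin n → ℝ) (s : ℕ → State n) (d : ℕ → ℝ)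
    (r : ℕ → Fin n → ℝ) : Prop where
  start : s 0 = State.init n
  phase : ∀ m, Phase α ρ p β (s m) (d m) (r m) (s (m + 1)).served
  time : ∀ m, (s (m + 1)).time = (s m).time + d m
  elapsed : ∀ m j, (s (m + 1)).elapsed j = (s m).elapsed j + d m * r m j

/-- The function `e` describes the elapsed times when, from each state `s m` on, the jobs are
processed at the rates `r m`. -/
def Interpolates (s : ℕ → State n) (r : ℕ → Fin n → ℝ) (e : Fin n → ℝ → ℝ) : Prop :=
  ∀ m j, Set.EqOn (e j) (fun t => (s m).elapsed j + (t - (s m).time) * r m j)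
    (Set.Icc (s m).time (s (m + 1)).time)

theorem isExecution_iff :
    IsExecution α ρ p β e ↔ ∃ s d r, IsPhaseSequence α ρ p β s d r ∧ Interpolates s r e :=
  ⟨fun ⟨s, d, r, h₀, h⟩ => ⟨s, d, r, ⟨h₀, fun m => (h m).1, fun m => (h m).2.1,
    fun m => (h m).2.2.1⟩, fun m => (h m).2.2.2⟩,
  fun ⟨s, d, r, h, he⟩ => ⟨s, d, r, h.start, fun m => ⟨h.phase m, h.time m, h.elapsed m, he m⟩⟩⟩

theorem exists_isPhaseSequence (α ρ : ℝ) (p β : Fin n → ℝ) :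
    ∃ s d r, IsPhaseSequence α ρ p β s d r := by
  choose d r S hS using exists_phase α ρ p β
  let next (s : State n) : State n := ⟨s.time + d s, fun j => s.elapsed j + d s * r s j, S s⟩
  let s (m : ℕ) : State n := next^[m] (State.init n)
  have hs (m : ℕ) : s (m + 1) = next (s m) := Function.iterate_succ_apply' _ _ _
  refine ⟨s, fun m => d (s m), fun m => r (s m), rfl, fun m => ?_, fun m => ?_, fun m j => ?_⟩
  · rw [hs]
    exact hS (s m)
  · rw [hs]
  · rw [hs]

section Execution

variable {s : ℕ → State n} {d : ℕ → ℝ} {r : ℕ → Fin n → ℝ}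

theorem IsPhaseSequence.isRun (h : IsPhaseSequence α ρ p β s d r) (hκ : 0 < α * ρ)
    (hκ1 : α * ρ ≤ 1) (hI : IsInstance p β) : IsRun (α * ρ) p β s :=
  ⟨hκ, hκ1, hI, h.start, fun m => (h.phase m).step (h.time m) (h.elapsed m)⟩

theorem IsPhaseSequence.exists_interpolates (h : IsPhaseSequence α ρ p β s d r)
    (hrun : IsRun κ p β s) : ∃ e, Interpolates s r e := by
  have hjoin (j : Fin n) (m : ℕ) :
      (s m).elapsed j + ((s (m + 1)).time - (s m).time) * r m j =
        (s (m + 1)).elapsed j + ((s (m + 1)).time - (s (m + 1)).time) * r (m + 1) j := by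
    rw [h.time, h.elapsed]
    ring
  choose e he using fun j => exists_eqOn_Icc_of_eq_at_right
    (g := fun m t => (s m).elapsed j + (t - (s m).time) * r m j) hrun.time_mono (hjoin j)
  exact ⟨e, fun m j => he j m⟩

theorem Interpolates.apply_time (he : Interpolates s r e) (hrun : IsRun κ p β s) (m : ℕ)
    (j : Fin n) : e j (s m).time = (s m).elapsed j := by
  simpa using he m j (Set.left_mem_Icc.2 (hrun.time_mono m.le_succ))

theorem Interpolates.monotoneOn (he : Interpolates s r e) (h : IsPhaseSequence α ρ p β s d r)
    (hrun : IsRun κ p β s) (j : Fin n) : MonotoneOn (e j) (Set.Ici 0) := by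
  have hmono := monotoneOn_Ici_of_monotoneOn_Icc (f := e j) hrun.time_mono hrun.exists_le_time
    fun m u hu t ht hut => by
      rw [he m j hu, he m j ht]
      dsimp only
      gcongr
      exact (h.phase m).rate_nonneg j
  simpa only [hrun.time_zero] using hmono

theorem Interpolates.monotoneOn_sub_sum (he : Interpolates s r e)
    (h : IsPhaseSequence α ρ p β s d r) (hrun : IsRun κ p β s) :
    MonotoneOn (fun t => t - ∑ j, e j t) (Set.Ici 0) := by
  have hmono := monotoneOn_Ici_of_monotoneOn_Icc (f := fun t => t - ∑ j, e j t) hrun.time_mono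
    hrun.exists_le_time fun m u hu t ht hut => by
      have hdiff (j : Fin n) : e j t - e j u = (t - u) * r m j := by
        rw [he m j hu, he m j ht]
        ring
      have hsum : ∑ j, e j t - ∑ j, e j u ≤ t - u := by
        rw [← Finset.sum_sub_distrib]
        simp only [hdiff, ← Finset.mul_sum]
        exact mul_le_of_le_one_right (sub_nonneg.2 hut) (h.phase m).sum_rate_le_one
      dsimp only
      linarith
  simpa only [hrun.time_zero] using hmono

theorem Interpolates.isSchedule (he : Interpolates s r e) (h : IsPhaseSequence α ρ p β s d r)
    (hrun : IsRun κ p β s) : IsSchedule p e where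
  start j := by simpa [h.start, State.init] using he.apply_time hrun 0 j
  mono j _ _ hu hut := he.monotoneOn h hrun j hu (hu.trans hut) hut
  speed u t hu hut := by
    have hidle := he.monotoneOn_sub_sum h hrun hu (hu.trans hut) hut
    dsimp only at hidle
    rw [Finset.sum_sub_distrib]
    linarith
  completes j := ⟨(s (finishIndex p s j)).time, hrun.time_nonneg _,
    (hrun.le_elapsed_finishIndex j).trans_eq (he.apply_time hrun _ j).symm⟩

theorem Interpolates.completionTime_le (he : Interpolates s r e) (hrun : IsRun κ p β s)
    (j : Fin n) : completionTime p e j ≤ ∑ i, delay p s i j :=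
  (SignalScheduling.completionTime_le (hrun.time_nonneg _)
    ((hrun.le_elapsed_finishIndex j).trans_eq (he.apply_time hrun _ j).symm)).trans_eq
    (hrun.time_eq_sum_elapsed le_rfl)

end Execution

theorem IsExecution.totalCompletionTime_le (he : IsExecution α ρ p β e) (hκ : 0 < α * ρ)
    (hκ1 : α * ρ ≤ 1) (hI : IsInstance p β) (hK : 1 ≤ K) (herr : ∀ j, 0 ≤ err j)
    (hpair : ∀ s, IsRun (α * ρ) p β s → ∀ i j, i ≠ j → p i ≤ p j →
      delay p s i j + delay p s j i ≤ K * p i + (err i + err j)) :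
    totalCompletionTime p e ≤ K * OPT p + n * ∑ i, err i := by
  obtain ⟨s, d, r, h, he⟩ := isExecution_iff.1 he
  have hrun := h.isRun hκ hκ1 hI
  calc totalCompletionTime p e
      ≤ ∑ j, ∑ i, delay p s i j := Finset.sum_le_sum fun j _ => he.completionTime_le hrun j
    _ ≤ K * OPT p + n * ∑ i, err i := sum_sum_le_mul_OPT_add hK hI.processing_nonneg herr
        (fun j => hrun.delay_le j j) (hpair s hrun)

/-! ### Guarantees -/

theorem isWellDefined (hκ : 0 < α * ρ) (hκ1 : α * ρ ≤ 1) : IsWellDefined (IsExecution α ρ) := by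
  refine fun n p β hI => ⟨?_, fun e he => ?_⟩
  · obtain ⟨s, d, r, h⟩ := exists_isPhaseSequence α ρ p β
    obtain ⟨e, he⟩ := h.exists_interpolates (h.isRun hκ hκ1 hI)
    exact ⟨e, isExecution_iff.2 ⟨s, d, r, h, he⟩⟩
  · obtain ⟨s, d, r, h, he⟩ := isExecution_iff.1 he
    exact he.isSchedule h (h.isRun hκ hκ1 hI)

theorem isConsistent (hα : α ∈ Set.Ioc 0 1) (hρ : ρ ∈ Set.Ioc 0 1) :
    IsConsistent α (IsExecution α ρ) (1 + α) := by
  intro n p β hI hβ e he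
  have hκα : α * ρ ≤ α := mul_le_of_le_one_right hα.1.le hρ.2
  have hpair (s : ℕ → State n) (hrun : IsRun (α * ρ) p β s) (i j : Fin n) (hij : i ≠ j) :
      delay p s i j + delay p s j i ≤ (1 + α) * p i := by
    simpa [signalError, hβ] using
      hrun.mutual_delay_le_of_signal hα.1 hα.2 hij (by rwa [hβ]) (by rwa [hβ])
  simpa using he.totalCompletionTime_le (mul_pos hα.1 hρ.1) (hκα.trans hα.2) hI
    (le_add_of_nonneg_right hα.1.le) (err := 0) (fun _ => le_rfl)
    fun s hrun i j hij _ => by simpa using hpair s hrun i j hij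

theorem isRobust (hκ : 0 < α * ρ) (hκ1 : α * ρ ≤ 1) :
    IsRobust (IsExecution α ρ) (1 + 1 / (ρ * α)) := by
  intro n p β hI e he
  rw [mul_comm ρ α]
  simpa using he.totalCompletionTime_le hκ hκ1 hI
    (le_add_of_nonneg_right (one_div_pos.2 hκ).le) (err := 0) (fun _ => le_rfl)
    fun s hrun i j _ _ => by simpa using hrun.mutual_delay_le i j

theorem IsExecution.totalCompletionTime_le_signalError (he : IsExecution α ρ p β e)
    (hα : α ∈ Set.Ioc 0 1) (hρ : ρ ∈ Set.Ioo 0 1) (hI : IsInstance p β) :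
    totalCompletionTime p e ≤ (1 + α) * OPT p +
      2 * n / (ρ * (1 - ρ) * α ^ 2) * ∑ i, signalError α p β i := by
  have hκ : 0 < α * ρ := mul_pos hα.1 hρ.1
  have hκα : α * ρ < α := mul_lt_of_lt_one_right hα.1 hρ.2
  have hc : 0 ≤ 2 * (1 / (α * ρ * (α - α * ρ))) :=
    mul_nonneg two_pos.le (one_div_nonneg.2 (mul_pos hκ (sub_pos.2 hκα)).le)
  calc totalCompletionTime p e
      ≤ (1 + α) * OPT p + n * ∑ i, 2 * (1 / (α * ρ * (α - α * ρ))) * signalError α p β i :=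
        he.totalCompletionTime_le hκ (hκα.le.trans hα.2) hI (le_add_of_nonneg_right hα.1.le)
          (fun j => mul_nonneg hc (hI.signalError_nonneg α j)) fun s hrun i j hij hp =>
            (hrun.mutual_delay_le_signalError hκα hα.2 hij hp).trans_eq (by rw [mul_add])
    _ = (1 + α) * OPT p + 2 * n / (ρ * (1 - ρ) * α ^ 2) * ∑ i, signalError α p β i := by
        rw [← Finset.mul_sum]
        ring

end SignalScheduling

theorem mainTheorem1 (α ρ : ℝ) (hα : α ∈ Set.Ioc (0 : ℝ) 1) (hρ : ρ ∈ Set.Ioc (0 : ℝ) 1) :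
    SignalScheduling.IsWellDefined (SignalScheduling.IsExecution α ρ) ∧
    SignalScheduling.IsConsistent α (SignalScheduling.IsExecution α ρ) (1 + α) ∧
    SignalScheduling.IsRobust (SignalScheduling.IsExecution α ρ) (1 + 1 / (ρ * α)) ∧
    (ρ < 1 → ∀ (n : ℕ) (p β : Fin n → ℝ), SignalScheduling.IsInstance p β →
      ∀ e, SignalScheduling.IsExecution α ρ p β e →
        SignalScheduling.totalCompletionTime p e ≤
          (1 + α) * SignalScheduling.OPT p +
            2 * n / (ρ * (1 - ρ) * α ^ 2) * ∑ i, |β i - α| * p i) := by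
  have hκ : 0 < α * ρ := mul_pos hα.1 hρ.1
  have hκ1 : α * ρ ≤ 1 := mul_le_one₀ hα.2 hρ.1.le hρ.2
  exact ⟨SignalScheduling.isWellDefined hκ hκ1, SignalScheduling.isConsistent hα hρ,
    SignalScheduling.isRobust hκ hκ1, fun hρ1 _ _ _ hI _ he =>
      he.totalCompletionTime_le_signalError hα ⟨hρ.1, hρ1⟩ hI⟩
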